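/- Let $G=(V,E)$ be a finite simple $k$-regular graph. Two distinct edges of $G$ are within distance $3$ if some path with at most $3$ vertices joins an endpoint of one to an endpoint of the other; let $\chi'_3(G)$ be the least number of colours needed to colour $E$ so that distinct edges within distance $3$ get distinct colours. Let $A'$ be the adjacency matrix of the line graph $L(G)$, let $\lambda'_1\ge\cdots\ge\lambda'_m$ ($m=|E|$) be its eigenvalues with multiplicity and $\theta'_0>\cdots>\theta'_{d'}$ its distinct eigenvalues, and assume $d'\ge 3$. Put $\Delta'_3=\max_{e\in E}((A')^3)_{ee}$. Then $\theta'_0=2(k-1)$, and $\theta'_{d'}=-2$ if $k\ge 3$. There is a largest eigenvalue $\theta'_s$ of $L(G)$ with $$\theta'_s\le-\frac{\theta_0'^2+\theta'_0\theta'_{d'}-\Delta'_3}{\theta'_0(\theta'_{d'}+1)},$$ and $2\le s\le d'-1$. With $$R=\frac{\Delta'_3-\theta'_0(\theta'_s+\theta'_{s-1}+\theta'_{d'})-\theta'_s\theta'_{s-1}\theta'_{d'}}{(\theta'_0-\theta'_s)(\theta'_0-\theta'_{s-1})(\theta'_0-\theta'_{d'})}$$ one has $\lfloor |E|R\rfloor\ge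 1$ and $$\chi'_3(G)\ \ge\ \frac{|E|}{\lfloor |E|\,R\rfloor}.$$ This bound is optimal in the following sense. For a real polynomial $p$ put $W'(p)=\max_{e\in E}(p(A'))_{ee}$ and $\lambda'(p)=\min_{2\le i\le m}p(\lambda'_i)$. Then $|E|/\lfloor |E|R\rfloor$ is the largest of the values $$\frac{|E|}{\left\lfloor |E|\,\frac{W'(p)-\lambda'(p)}{p(\lambda'_1)-\lambda'(p)}\right\rfloor},$$ where $p$ ranges over the real polynomials of degree at most $3$ with $p(\lambda'_1)>\lambda'(p)$. -/

import Mathlib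

/-- The distance between two distinct edges `e`, `f` is the number of vertices in a shortest path
from an endpoint of `e` to an endpoint of `f`; the edges are within distance `t` if there is such
a path with at most `t` vertices. (Incident edges are at distance `1`.) -/
def EdgesWithinDist {V : Type*} (G : SimpleGraph V) (t : ℕ) (e f : G.edgeSet) : Prop :=
  ∃ u ∈ (e : Sym2 V), ∃ v ∈ (f : Sym2 V), ∃ q : G.Walk u v, q.IsPath ∧ q.support.length ≤ t

/-- A distance-`t` edge-colouring: distinct edges within distance `t` get distinct colours. -/
def IsDistEdgeColouring {V : Type*} (G : SimpleGraph V) (t : ℕ) {C : Type*}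
    (c : G.edgeSet → C) : Prop :=
  ∀ e f : G.edgeSet, e ≠ f → EdgesWithinDist G t e f → c e ≠ c f

/-- The distance-`t` chromatic index of a finite graph: the least number of colours in a
distance-`t` edge-colouring. -/
noncomputable def distChromaticIndex {V : Type*} (G : SimpleGraph V) (t : ℕ) : ℕ :=
  sInf {n : ℕ | ∃ c : G.edgeSet → Fin n, IsDistEdgeColouring G t c}

/-- The largest diagonal entry of a real square matrix. -/
noncomputable def maxDiag {ι : Type*} (M : Matrix ι ι ℝ) : ℝ := ⨆ i, M i i

/-- The adjacency eigenvalues of `H` with multiplicity, in non-increasing order, indexed from `0`: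
`adjEigenvalue H 0 ≥ adjEigenvalue H 1 ≥ ⋯ ≥ adjEigenvalue H (m - 1)`, `m` the number of
vertices. (The value for an index `≥ m` is irrelevant.) -/
noncomputable def adjEigenvalue {W : Type*} [Fintype W] [DecidableEq W] (H : SimpleGraph W)
    [DecidableRel H.Adj] (i : ℕ) : ℝ :=
  if h : i < Fintype.card W then
    (show (H.adjMatrix ℝ).IsHermitian from H.isSymm_adjMatrix).eigenvalues₀ ⟨i, h⟩
  else 0

/-- The minimum of `p` over all adjacency eigenvalues of `H`, listed with multiplicity, except
the first (largest) one in the list. -/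
noncomputable def minEvalTail {W : Type*} [Fintype W] [DecidableEq W] (H : SimpleGraph W)
    [DecidableRel H.Adj] (p : Polynomial ℝ) : ℝ :=
  sInf ((fun i => p.eval (adjEigenvalue H i)) '' Set.Ico 1 (Fintype.card W))

/-- The value of the (rounded) Hoffman-type bound that the polynomial `p` gives for `H`, where
`m` is the number of vertices and `A` the adjacency matrix of `H`:
`m / ⌊m * (W(p) - l(p)) / (p(l₁) - l(p))⌋`, with `W(p)` the largest diagonal entry of `p(A)`, `l₁`
the largest eigenvalue and `l(p)` the minimum of `p` over the other eigenvalues in the list. -/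
noncomputable def hoffmanTypeBound {W : Type*} [Fintype W] [DecidableEq W] (H : SimpleGraph W)
    [DecidableRel H.Adj] (p : Polynomial ℝ) : ℝ :=
  (Fintype.card W : ℝ) /
    (⌊(Fintype.card W : ℝ) *
      ((maxDiag (Polynomial.aeval (H.adjMatrix ℝ) p) - minEvalTail H p) /
        (p.eval (adjEigenvalue H 0) - minEvalTail H p))⌋ : ℤ)

/-- `x₀ > x₁ > ⋯ > x_d` are the distinct adjacency eigenvalues of `H`. -/
def AreDistinctEigenvalues {W : Type*} [Fintype W] [DecidableEq W] (H : SimpleGraph W)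
    [DecidableRel H.Adj] (d : ℕ) (x : ℕ → ℝ) : Prop :=
  StrictAntiOn x (Set.Iic d) ∧ x '' Set.Iic d = spectrum ℝ (H.adjMatrix ℝ)

/-- The rational expression
`(D - x₀ (a + b + z) - a b z) / ((x₀ - a) (x₀ - b) (x₀ - z))`. -/
noncomputable def cubicRatio (D x₀ a b z : ℝ) : ℝ :=
  (D - x₀ * (a + b + z) - a * b * z) / ((x₀ - a) * (x₀ - b) * (x₀ - z))

/-!
Let `A` be the adjacency matrix of the line graph `H` of `G`. With `B` the incidence matrix of `G`,
`Bᵀ B = A + 2`, so `H` is regular of degree `2 (k - 1)`, its spectrum lies in `[-2, ∞)`, and `-2` is an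
eigenvalue once `G` has more edges than vertices. Edges not within distance `3` have no walk of
length at most `3` between them in `H`, so a colour class of a distance-`3` edge-colouring is a set
on which `p(A)` is diagonal for every cubic `p`, and Hoffman's ratio bound
`card_mul_eval_le_of_aeval_apply_eq_zero` limits its size.

The rest concerns any regular graph with eigenvalues `θ₀ > ⋯ > θ_d`. Fix a vertex `v` with the most
closed `3`-walks. The functional `Φ(p) = p(A)_vv` has moments `1, 0, θ₀, D` up to degree `3` and is
nonnegative on polynomials that are nonnegative on the spectrum. The threshold is the mean of `x`
for the weight `(θ₀ - x) (x - θ_d)` under `Φ`, so it is at least `θ_{d-1}` and at most `θ₁`. Equality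
with `θ₁` is excluded by the maximality of `v`: it would give the positive semidefinite matrix
`(θ₀ - A) (A - θ_d) (θ₁ - A)` a zero diagonal, so that there would be only three eigenvalues.
The same device (`cubic_eq_zero_of_diag_nonpos`) shows `θ₀ > 0` and `θ_d < -1`. These facts need no
connectedness.

Minimizing the Hoffman-type ratio over cubics is a linear program. The cubic
`(x - θ_s) (x - θ_{s-1}) (x - θ_d)` attains `cubicRatio`, and the dual certificate `cubicRatio_le`
writes `Φ` as a combination of evaluations at `θ₀, θ_{s-1}, θ_s, θ_d`; the position of the threshold
between `θ_s` and `θ_{s-1}` says exactly that the weights at these two points are nonnegative.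
-/

open Matrix Polynomial

/-! ### Polynomials in a symmetric matrix -/

theorem posSemidef_aeval {ι : Type*} [Fintype ι] [DecidableEq ι] {M : Matrix ι ι ℝ}
    (hM : M.IsHermitian) {p : ℝ[X]} (hp : ∀ x ∈ spectrum ℝ M, 0 ≤ p.eval x) :
    (aeval M p).PosSemidef := by
  have hsa : IsSelfAdjoint M := hM
  rw [Matrix.posSemidef_iff_isHermitian_and_spectrum_nonneg, ← cfc_polynomial p M hsa]
  refine ⟨cfc_predicate p.eval M, ?_⟩
  rw [cfc_map_spectrum p.eval M hsa (by fun_prop)]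
  rintro _ ⟨x, hx, rfl⟩
  exact hp x hx

/-- A positive semidefinite matrix with zero diagonal vanishes, so a polynomial that is nonnegative
on the spectrum and gives zero diagonal vanishes on the spectrum. -/
theorem eval_eq_zero_of_diag_aeval_eq_zero {ι : Type*} [Fintype ι] [DecidableEq ι]
    {M : Matrix ι ι ℝ} (hM : M.IsHermitian) {p : ℝ[X]}
    (hp : ∀ x ∈ spectrum ℝ M, 0 ≤ p.eval x) (hdiag : ∀ i, aeval M p i i = 0) :
    ∀ x ∈ spectrum ℝ M, p.eval x = 0 := by
  intro x hx
  have hzero : aeval M p = 0 := (posSemidef_aeval hM hp).trace_eq_zero_iff.mp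
    (Finset.sum_eq_zero fun i _ => hdiag i)
  have hsa : IsSelfAdjoint M := hM
  have hmem : p.eval x ∈ spectrum ℝ (aeval M p) := by
    rw [← cfc_polynomial p M hsa, cfc_map_spectrum p.eval M hsa (by fun_prop)]
    exact ⟨x, hx, rfl⟩
  rw [hzero] at hmem
  have : Nontrivial (Matrix ι ι ℝ) := by
    by_contra h
    rw [not_nontrivial_iff_subsingleton] at h
    exact absurd hx (by simp [spectrum.of_subsingleton])
  simpa [spectrum.zero_eq] using hmem

theorem aeval_mulVec_of_mulVec_eq_smul {ι : Type*} [Fintype ι] [DecidableEq ι]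
    {M : Matrix ι ι ℝ} {v : ι → ℝ} {r : ℝ} (h : M *ᵥ v = r • v) (p : ℝ[X]) :
    aeval M p *ᵥ v = p.eval r • v := by
  induction p using Polynomial.induction_on' with
  | add p q hp hq => simp [add_mulVec, hp, hq, add_smul]
  | monomial n a =>
    have hpow : M ^ n *ᵥ v = r ^ n • v := by
      induction n with
      | zero => simp
      | succ n ih => rw [pow_succ, ← mulVec_mulVec, h, mulVec_smul, ih, smul_smul, pow_succ']
    rw [aeval_monomial, Algebra.algebraMap_eq_smul_one, smul_mul_assoc, one_mul, smul_mulVec,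
      hpow, eval_monomial, smul_smul]

theorem mem_spectrum_of_mulVec_eq_smul {ι : Type*} [Fintype ι] [DecidableEq ι]
    {M : Matrix ι ι ℝ} {v : ι → ℝ} (hv : v ≠ 0) {r : ℝ} (h : M *ᵥ v = r • v) :
    r ∈ spectrum ℝ M := by
  rw [spectrum.mem_iff]
  intro hu
  rw [isUnit_iff_isUnit_det, isUnit_iff_ne_zero] at hu
  refine hu (exists_mulVec_eq_zero_iff.mp ⟨v, hv, ?_⟩)
  rw [sub_mulVec, h, Algebra.algebraMap_eq_smul_one, smul_mulVec, one_mulVec, sub_self]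

/-- Hoffman's ratio bound for a family of indices on which `p(M)` is diagonal. The positive
semidefinite form of `p(M)` is evaluated at the indicator of `S` minus its mean. -/
theorem card_mul_eval_le_of_aeval_apply_eq_zero {ι : Type*} [Fintype ι] [DecidableEq ι]
    {M : Matrix ι ι ℝ} (hM : M.IsHermitian) {r : ℝ} (hr : M *ᵥ (fun _ => 1) = r • fun _ => 1)
    {p : ℝ[X]} (hp : ∀ x ∈ spectrum ℝ M, 0 ≤ p.eval x) {w : ℝ} {S : Finset ι}
    (hS : S.Nonempty) (hoff : ∀ i ∈ S, ∀ j ∈ S, i ≠ j → aeval M p i j = 0)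
    (hdiag : ∀ i ∈ S, aeval M p i i ≤ w) :
    S.card * p.eval r ≤ Fintype.card ι * w := by
  have hpsd := posSemidef_aeval hM hp
  set N := aeval M p with hN
  have hN1 : N *ᵥ (fun _ => 1) = p.eval r • fun _ => 1 := aeval_mulVec_of_mulVec_eq_smul hr p
  set y : ι → ℝ := fun i => if i ∈ S then 1 else 0 with hy
  have hs : (0 : ℝ) < S.card := by exact_mod_cast hS.card_pos
  have hm : (0 : ℝ) < Fintype.card ι := by
    obtain ⟨i, -⟩ := hS
    exact_mod_cast Fintype.card_pos_iff.mpr ⟨i⟩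
  set c : ℝ := S.card / Fintype.card ι with hc
  have hyN : y ⬝ᵥ (N *ᵥ y) ≤ S.card * w := by
    have : y ⬝ᵥ (N *ᵥ y) = ∑ i ∈ S, N i i := by
      simp only [dotProduct, mulVec, hy, ite_mul, one_mul, zero_mul, mul_ite, mul_one, mul_zero,
        Finset.sum_ite_mem, Finset.univ_inter]
      refine Finset.sum_congr rfl fun i hi => ?_
      exact Finset.sum_eq_single i (fun j hj hji => hoff i hi j hj hji.symm) (fun h => absurd hi h)
    rw [this, ← nsmul_eq_mul]
    exact Finset.sum_le_card_nsmul S _ w hdiag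
  have h1y : (fun _ => (1 : ℝ)) ⬝ᵥ y = S.card := by simp [dotProduct, hy]
  have hy1 : y ⬝ᵥ (fun _ => (1 : ℝ)) = S.card := by simp [dotProduct, hy]
  have h11 : (fun _ : ι => (1 : ℝ)) ⬝ᵥ (fun _ => (1 : ℝ)) = Fintype.card ι := by
    simp [dotProduct]
  have h1N : (fun _ => (1 : ℝ)) ⬝ᵥ (N *ᵥ y) = p.eval r * S.card := by
    have hT : Nᵀ = N := (conjTranspose_eq_transpose_of_trivial N).symm.trans hpsd.isHermitian
    rw [dotProduct_mulVec, ← mulVec_transpose, hT, hN1, smul_dotProduct, h1y, smul_eq_mul]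
  have hq := hpsd.dotProduct_mulVec_nonneg (y - c • fun _ => 1)
  rw [star_trivial, mulVec_sub, mulVec_smul, hN1, sub_dotProduct, dotProduct_sub, dotProduct_sub,
    smul_dotProduct, smul_dotProduct, dotProduct_smul, dotProduct_smul, dotProduct_smul,
    dotProduct_smul, h1N, hy1, h11] at hq
  simp only [smul_eq_mul] at hq
  have hcm : c * Fintype.card ι = S.card := div_mul_cancel₀ _ hm.ne'
  have hq' : S.card * (c * p.eval r) ≤ S.card * w := by nlinarith [congrArg (· * (c * p.eval r)) hcm]
  have := le_of_mul_le_mul_left hq' hs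
  calc S.card * p.eval r = Fintype.card ι * (c * p.eval r) := by rw [← hcm]; ring
    _ ≤ _ := by gcongr

/-! ### Distances between edges and the line graph -/

theorem SimpleGraph.exists_walk_of_lineGraph_walk {V : Type*} {G : SimpleGraph V}
    {e f : G.edgeSet} (q : G.lineGraph.Walk e f) (hne : e ≠ f) :
    ∃ u ∈ (e : Sym2 V), ∃ v ∈ (f : Sym2 V), ∃ w : G.Walk u v, w.length + 1 ≤ q.length := by
  induction q with
  | nil => exact absurd rfl hne
  | @cons e g f h q ih =>
    obtain ⟨-, u, hue, hug⟩ := G.lineGraph_adj_iff_exists.mp h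
    by_cases hgf : g = f
    · subst hgf
      exact ⟨u, hue, u, hug, .nil, by simp⟩
    · obtain ⟨v, hvg, x, hxf, w, hw⟩ := ih hgf
      by_cases huv : u = v
      · subst huv
        exact ⟨u, hue, x, hxf, w, by simpa using hw.trans (Nat.le_succ _)⟩
      · have hadj : G.Adj u v := by
          have : (g : Sym2 V) = s(u, v) := (Sym2.mem_and_mem_iff huv).mp ⟨hug, hvg⟩
          rw [← G.mem_edgeSet, ← this]
          exact g.2
        exact ⟨u, hue, x, hxf, .cons hadj w, by simpa using hw⟩

theorem edgesWithinDist_of_lineGraph_walk {V : Type*} {G : SimpleGraph V} {t : ℕ}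
    {e f : G.edgeSet} (hne : e ≠ f) (q : G.lineGraph.Walk e f) (hq : q.length ≤ t) :
    EdgesWithinDist G t e f := by
  classical
  obtain ⟨u, hu, v, hv, w, hw⟩ := G.exists_walk_of_lineGraph_walk q hne
  refine ⟨u, hu, v, hv, w.toPath, w.toPath.2, ?_⟩
  rw [SimpleGraph.Walk.length_support]
  have h2 : (w.toPath : G.Walk u v).length ≤ w.length := w.length_bypass_le_length
  omega

theorem aeval_adjMatrix_apply_eq_zero {W : Type*} [Fintype W] [DecidableEq W] {H : SimpleGraph W}
    [DecidableRel H.Adj] {u v : W} {p : ℝ[X]}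
    (h : ∀ q : H.Walk u v, p.natDegree < q.length) :
    aeval (H.adjMatrix ℝ) p u v = 0 := by
  rw [aeval_eq_sum_range, Matrix.sum_apply]
  refine Finset.sum_eq_zero fun n hn => ?_
  rw [Matrix.smul_apply, H.adjMatrix_pow_apply_eq_card_walk]
  have : IsEmpty {q : H.Walk u v | q.length = n} := by
    refine ⟨fun ⟨q, hq⟩ => ?_⟩
    have := h q
    simp only [Set.mem_ofPred_eq, Finset.mem_range] at hq hn
    omega
  simp

/-- The colour classes of an optimal colouring are families of edges pairwise not within distance
`t`. -/
theorem card_le_distChromaticIndex_mul {V : Type*} (G : SimpleGraph V) [Fintype G.edgeSet]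
    {t N : ℕ} (hN : ∀ S : Finset G.edgeSet,
      (∀ e ∈ S, ∀ f ∈ S, e ≠ f → ¬ EdgesWithinDist G t e f) → S.card ≤ N) :
    Fintype.card G.edgeSet ≤ distChromaticIndex G t * N := by
  classical
  have hne : {n : ℕ | ∃ c : G.edgeSet → Fin n, IsDistEdgeColouring G t c}.Nonempty :=
    ⟨_, Fintype.equivFin _, fun e f hef _ h => hef ((Fintype.equivFin _).injective h)⟩
  obtain ⟨c, hc⟩ := Nat.sInf_mem hne
  change (Fintype.card G.edgeSet) ≤ sInf _ * N
  have := Finset.card_le_mul_card_image_of_maps_to (s := Finset.univ) (t := Finset.univ)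
    (f := c) (fun _ _ => Finset.mem_univ _) N (fun i _ => hN _ fun e he f hf hef hd => by
      simp only [Finset.mem_filter, Finset.mem_univ, true_and] at he hf
      exact hc e f hef hd (he.trans hf.symm))
  simpa [mul_comm] using this

/-! ### The spectrum of a line graph -/

/-- The vertex-edge incidence matrix, with columns indexed by the edges only. -/
noncomputable def edgeIncMatrix {V : Type*} [DecidableEq V] (G : SimpleGraph V) :
    Matrix V G.edgeSet ℝ :=
  .of fun v e => if v ∈ (e : Sym2 V) then 1 else 0

theorem edgeIncMatrix_transpose_mul_self {V : Type*} [Fintype V] [DecidableEq V]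
    (G : SimpleGraph V) [DecidableRel G.lineGraph.Adj] :
    (edgeIncMatrix G)ᵀ * edgeIncMatrix G = G.lineGraph.adjMatrix ℝ + (2 : ℝ) • 1 := by
  ext ⟨e, he⟩ ⟨f, hf⟩
  induction e with | _ a b
  have hab : a ≠ b := G.ne_of_adj he
  have hsum : ((edgeIncMatrix G)ᵀ * edgeIncMatrix G) ⟨s(a, b), he⟩ ⟨f, hf⟩ =
      (if a ∈ f then 1 else 0) + (if b ∈ f then 1 else 0) := by
    simp only [mul_apply, transpose_apply, edgeIncMatrix, of_apply, ite_mul, one_mul, zero_mul,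
      Sym2.mem_iff]
    rw [← Finset.sum_filter]
    have : (Finset.univ.filter fun x => x = a ∨ x = b) = {a, b} := by ext; simp
    rw [this, Finset.sum_pair hab]
  rw [hsum, Matrix.add_apply, Matrix.smul_apply, Matrix.one_apply, SimpleGraph.adjMatrix_apply]
  by_cases hef : s(a, b) = f
  · subst hef
    simp
    norm_num
  · have hnot : ¬ (a ∈ f ∧ b ∈ f) := fun h => hef ((Sym2.mem_and_mem_iff hab).mp h).symm
    have hadj : G.lineGraph.Adj ⟨s(a, b), he⟩ ⟨f, hf⟩ ↔ (a ∈ f ∨ b ∈ f) := by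
      rw [SimpleGraph.lineGraph_adj_iff_exists]
      simp [hef]
    simp only [hadj, Subtype.mk.injEq, hef]
    by_cases ha : a ∈ f <;> by_cases hb : b ∈ f <;> simp_all

/-- The row sums of `Bᵀ B`, with `B` the incidence matrix, are `2 k`. -/
theorem degree_lineGraph_of_isRegularOfDegree {V : Type*} [Fintype V] [DecidableEq V]
    {G : SimpleGraph V} [DecidableRel G.Adj] [DecidableRel G.lineGraph.Adj]
    {k : ℕ} (hk : G.IsRegularOfDegree k) (e : G.edgeSet) :
    (G.lineGraph.degree e : ℝ) = 2 * ((k : ℝ) - 1) := by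
  have hone : edgeIncMatrix G *ᵥ (fun _ => 1) = fun _ => (k : ℝ) := by
    ext v
    have h1 : (edgeIncMatrix G *ᵥ fun _ => (1 : ℝ)) v = (G.incidenceFinset v).card := by
      simp only [mulVec, dotProduct, edgeIncMatrix, of_apply, mul_one]
      rw [G.incidenceFinset_eq_filter, ← Finset.sum_boole]
      exact (Finset.sum_subtype G.edgeFinset (fun e => G.mem_edgeFinset)
        (fun e => if v ∈ e then (1 : ℝ) else 0)).symm
    rw [h1, G.card_incidenceFinset_eq_degree, hk v]
  have htwo : (edgeIncMatrix G)ᵀ *ᵥ (fun _ => (k : ℝ)) = fun _ => 2 * (k : ℝ) := by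
    ext ⟨e, he⟩
    induction e with | _ a b
    have hab : a ≠ b := G.ne_of_adj he
    simp only [mulVec, dotProduct, edgeIncMatrix, of_apply, transpose_apply, ite_mul, one_mul,
      zero_mul, Sym2.mem_iff]
    rw [← Finset.sum_filter]
    have : (Finset.univ.filter fun x => x = a ∨ x = b) = {a, b} := by ext; simp
    rw [this, Finset.sum_pair hab]
    ring
  have h := congrFun (congrArg (· *ᵥ fun _ => (1 : ℝ)) (edgeIncMatrix_transpose_mul_self G)) e
  have hdeg : (G.lineGraph.adjMatrix ℝ *ᵥ fun _ => (1 : ℝ)) e = G.lineGraph.degree e :=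
    (G.lineGraph.adjMatrix_mulVec_const_apply (a := (1 : ℝ))).trans (mul_one _)
  simp only [← mulVec_mulVec, hone, htwo, add_mulVec, smul_mulVec, one_mulVec, Pi.add_apply,
    hdeg, Pi.smul_apply, smul_eq_mul, mul_one] at h
  linarith

theorem neg_two_le_of_mem_spectrum_lineGraph {V : Type*} [Fintype V] [DecidableEq V]
    {G : SimpleGraph V} [DecidableRel G.Adj] [DecidableRel G.lineGraph.Adj]
    {x : ℝ}
    (hx : x ∈ spectrum ℝ (G.lineGraph.adjMatrix ℝ)) : -2 ≤ x := by
  have hpsd : ((edgeIncMatrix G)ᵀ * edgeIncMatrix G).PosSemidef := by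
    simpa using posSemidef_conjTranspose_mul_self (edgeIncMatrix G)
  rw [edgeIncMatrix_transpose_mul_self] at hpsd
  have h := (Matrix.posSemidef_iff_isHermitian_and_spectrum_nonneg.mp hpsd).2
  have hmem : x + 2 ∈ spectrum ℝ (G.lineGraph.adjMatrix ℝ + (2 : ℝ) • 1) := by
    rw [← Algebra.algebraMap_eq_smul_one]
    rw [spectrum.add_mem_iff]
    simpa using hx
  have := h hmem
  simp at this
  linarith

theorem neg_two_mem_spectrum_lineGraph {V : Type*} [Fintype V] [DecidableEq V]
    {G : SimpleGraph V} [DecidableRel G.Adj] [DecidableRel G.lineGraph.Adj]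
    (h : Fintype.card V < Fintype.card G.edgeSet) :
    -2 ∈ spectrum ℝ (G.lineGraph.adjMatrix ℝ) := by
  have hker : LinearMap.ker (edgeIncMatrix G).mulVecLin ≠ ⊥ :=
    LinearMap.ker_ne_bot_of_finrank_lt (by simpa using h)
  obtain ⟨x, hx, hx0⟩ := (Submodule.ne_bot_iff _).mp hker
  refine mem_spectrum_of_mulVec_eq_smul hx0 ?_
  have hBx : edgeIncMatrix G *ᵥ x = 0 := hx
  have h0 := congrArg (· *ᵥ x) (edgeIncMatrix_transpose_mul_self G)
  simp only [← mulVec_mulVec, hBx, mulVec_zero, add_mulVec, smul_mulVec, one_mulVec] at h0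
  rw [neg_smul]
  exact eq_neg_of_add_eq_zero_left h0.symm

theorem card_lt_card_edgeSet {V : Type*} [Fintype V] [DecidableEq V] [Nonempty V]
    (G : SimpleGraph V) [DecidableRel G.Adj] {k : ℕ} (hk : G.IsRegularOfDegree k) (h3 : 3 ≤ k) :
    Fintype.card V < Fintype.card G.edgeSet := by
  have h := G.sum_degrees_eq_twice_card_edges
  simp only [hk.degree_eq, Finset.sum_const, Finset.card_univ, smul_eq_mul,
    SimpleGraph.edgeFinset_card] at h
  have hV : 0 < Fintype.card V := Fintype.card_pos
  have hmul := Nat.mul_le_mul_left (Fintype.card V) h3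
  omega

/-! ### Adjacency eigenvalues -/

section
variable {W : Type*} [Fintype W] [DecidableEq W] {H : SimpleGraph W} [DecidableRel H.Adj]

omit [Fintype W] [DecidableEq W] in
theorem isHermitian_adjMatrix : (H.adjMatrix ℝ).IsHermitian := H.isSymm_adjMatrix

theorem adjEigenvalue_mem_spectrum {i : ℕ} (hi : i < Fintype.card W) :
    adjEigenvalue H i ∈ spectrum ℝ (H.adjMatrix ℝ) := by
  have h := isHermitian_adjMatrix (H := H)
  rw [adjEigenvalue, dif_pos hi, h.spectrum_real_eq_range_eigenvalues]
  exact ⟨Fintype.equivOfCardEq (Fintype.card_fin _) ⟨i, hi⟩, by simp [IsHermitian.eigenvalues]⟩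

theorem exists_adjEigenvalue_eq {x : ℝ} (hx : x ∈ spectrum ℝ (H.adjMatrix ℝ)) :
    ∃ i < Fintype.card W, adjEigenvalue H i = x := by
  have h := isHermitian_adjMatrix (H := H)
  rw [h.spectrum_real_eq_range_eigenvalues] at hx
  obtain ⟨w, rfl⟩ := hx
  refine ⟨(Fintype.equivOfCardEq (Fintype.card_fin _)).symm w, Fin.is_lt _, ?_⟩
  rw [adjEigenvalue, dif_pos (Fin.is_lt _)]
  rfl

theorem isGreatest_adjEigenvalue_zero [Nonempty W] :
    IsGreatest (spectrum ℝ (H.adjMatrix ℝ)) (adjEigenvalue H 0) := by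
  refine ⟨adjEigenvalue_mem_spectrum Fintype.card_pos, fun x hx => ?_⟩
  obtain ⟨i, hi, rfl⟩ := exists_adjEigenvalue_eq hx
  rw [adjEigenvalue, adjEigenvalue, dif_pos hi, dif_pos Fintype.card_pos]
  exact isHermitian_adjMatrix.eigenvalues₀_antitone (Nat.zero_le i)

theorem minEvalTail_le {p : ℝ[X]} {x : ℝ} (hx : x ∈ spectrum ℝ (H.adjMatrix ℝ))
    (hx0 : x ≠ adjEigenvalue H 0) : minEvalTail H p ≤ p.eval x := by
  obtain ⟨i, hi, rfl⟩ := exists_adjEigenvalue_eq hx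
  refine csInf_le ((Set.finite_Ico _ _).image _).bddBelow ⟨i, ⟨?_, hi⟩, rfl⟩
  exact Nat.one_le_iff_ne_zero.mpr fun h => hx0 (by rw [h])

theorem minEvalTail_eq_zero {p : ℝ[X]} (hp : ∀ x ∈ spectrum ℝ (H.adjMatrix ℝ), 0 ≤ p.eval x)
    {x : ℝ} (hx : x ∈ spectrum ℝ (H.adjMatrix ℝ)) (hx0 : x ≠ adjEigenvalue H 0)
    (hpx : p.eval x = 0) : minEvalTail H p = 0 := by
  refine le_antisymm (hpx ▸ minEvalTail_le hx hx0) (Real.sInf_nonneg ?_)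
  rintro _ ⟨i, ⟨-, hi⟩, rfl⟩
  exact hp _ (adjEigenvalue_mem_spectrum hi)

/-! ### Regular graphs and cubic polynomials -/

variable {r : ℝ}

omit [DecidableEq W] in
theorem adjMatrix_mulVec_one_of_degree_eq (hr : ∀ v, (H.degree v : ℝ) = r) :
    H.adjMatrix ℝ *ᵥ (fun _ => 1) = r • fun _ => 1 := by
  ext v
  refine (H.adjMatrix_mulVec_const_apply (a := (1 : ℝ))).trans ?_
  simp [hr v]

theorem isGreatest_spectrum_adjMatrix [Nonempty W] (hr : ∀ v, (H.degree v : ℝ) = r) :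
    IsGreatest (spectrum ℝ (H.adjMatrix ℝ)) r := by
  refine ⟨mem_spectrum_of_mulVec_eq_smul (v := fun _ => 1)
    (fun h => one_ne_zero (congrFun h (Classical.arbitrary W)))
    (adjMatrix_mulVec_one_of_degree_eq hr), fun x hx => ?_⟩
  have hL : H.lapMatrix ℝ = algebraMap ℝ _ r - H.adjMatrix ℝ := by
    rw [SimpleGraph.lapMatrix, SimpleGraph.degMatrix, Matrix.algebraMap_eq_diagonal]
    congr 2
    ext v
    simp [hr v]
  have hpsd := H.posSemidef_lapMatrix ℝ
  rw [hL] at hpsd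
  have hmem : r - x ∈ spectrum ℝ (algebraMap ℝ _ r - H.adjMatrix ℝ) := by
    rw [← spectrum.singleton_sub_eq]
    exact ⟨r, rfl, x, hx, rfl⟩
  exact sub_nonneg.mp ((Matrix.posSemidef_iff_isHermitian_and_spectrum_nonneg.mp hpsd).2 hmem)

theorem aeval_adjMatrix_apply_self (hr : ∀ v, (H.degree v : ℝ) = r) {p : ℝ[X]}
    (hp : p.natDegree ≤ 3) (v : W) :
    aeval (H.adjMatrix ℝ) p v v =
      p.coeff 3 * (H.adjMatrix ℝ ^ 3) v v + p.coeff 2 * r + p.coeff 0 := by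
  rw [aeval_eq_sum_range' (Nat.lt_succ_of_le hp), Matrix.sum_apply]
  simp only [Finset.sum_range_succ, Finset.sum_range_zero, Matrix.smul_apply, pow_zero, pow_one,
    Matrix.one_apply_eq, smul_eq_mul, pow_two, H.adjMatrix_mul_self_apply_self, hr]
  simp
  ring

theorem aeval_cubic_adjMatrix_apply_self (hr : ∀ v, (H.degree v : ℝ) = r) (c₃ c₂ c₁ c₀ : ℝ)
    (v : W) :
    aeval (H.adjMatrix ℝ) (C c₃ * X ^ 3 + C c₂ * X ^ 2 + C c₁ * X + C c₀) v v =
      c₃ * (H.adjMatrix ℝ ^ 3) v v + c₂ * r + c₀ := by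
  rw [aeval_adjMatrix_apply_self hr natDegree_cubic_le]
  simp [coeff_X, coeff_C]

/-- The diagonal entry of a cubic in the adjacency matrix depends on the coefficients only through
the moments `1, 0, r` and the number of closed `3`-walks, and is nonnegative for a cubic that is
nonnegative on the spectrum. -/
theorem diag_cubic_nonneg (hr : ∀ v, (H.degree v : ℝ) = r) {c₃ c₂ c₁ c₀ : ℝ}
    (h : ∀ x ∈ spectrum ℝ (H.adjMatrix ℝ), 0 ≤ c₃ * x ^ 3 + c₂ * x ^ 2 + c₁ * x + c₀) (v : W) :
    0 ≤ c₃ * (H.adjMatrix ℝ ^ 3) v v + c₂ * r + c₀ := by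
  have hpsd := posSemidef_aeval (isHermitian_adjMatrix (H := H))
    (p := C c₃ * X ^ 3 + C c₂ * X ^ 2 + C c₁ * X + C c₀) (by simpa using h)
  have := hpsd.diag_nonneg (i := v)
  rwa [aeval_cubic_adjMatrix_apply_self hr] at this

theorem cubic_eq_zero_of_diag_nonpos (hr : ∀ v, (H.degree v : ℝ) = r) {c₃ c₂ c₁ c₀ : ℝ}
    (h : ∀ x ∈ spectrum ℝ (H.adjMatrix ℝ), 0 ≤ c₃ * x ^ 3 + c₂ * x ^ 2 + c₁ * x + c₀)
    (hdiag : ∀ v, c₃ * (H.adjMatrix ℝ ^ 3) v v + c₂ * r + c₀ ≤ 0) :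
    ∀ x ∈ spectrum ℝ (H.adjMatrix ℝ), c₃ * x ^ 3 + c₂ * x ^ 2 + c₁ * x + c₀ = 0 := by
  have := eval_eq_zero_of_diag_aeval_eq_zero (isHermitian_adjMatrix (H := H))
    (p := C c₃ * X ^ 3 + C c₂ * X ^ 2 + C c₁ * X + C c₀) (by simpa using h) fun v => by
      rw [aeval_cubic_adjMatrix_apply_self hr]
      exact (hdiag v).antisymm (diag_cubic_nonneg hr h v)
  simpa using this

theorem le_maxDiag {ι : Type*} [Finite ι] (M : Matrix ι ι ℝ) (i : ι) : M i i ≤ maxDiag M :=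
  le_ciSup (f := fun i => M i i) (Set.finite_range _).bddAbove i

theorem exists_eq_maxDiag {ι : Type*} [Finite ι] [Nonempty ι] (M : Matrix ι ι ℝ) :
    ∃ i, M i i = maxDiag M :=
  exists_eq_ciSup_of_finite (f := fun i => M i i)

/-- The dual certificate: the linear functional with moments `1, 0, x₀, D` is a combination of the
evaluations at `x₀, a, b, z` whose weight at `x₀` is `cubicRatio D x₀ a b z` and whose three other
weights are nonnegative. -/
theorem cubicRatio_le {D x₀ a b z : ℝ} (hza : z < a) (hab : a < b) (hbx : b < x₀)
    (ha : 0 ≤ D - x₀ * (x₀ + b + z) - x₀ * b * z)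
    (hb : 0 ≤ x₀ * (x₀ + a + z) + x₀ * a * z - D)
    (hz : 0 ≤ x₀ * (x₀ + a + b) + x₀ * a * b - D)
    {c : ℕ → ℝ} {l w : ℝ}
    (hla : l ≤ c 3 * a ^ 3 + c 2 * a ^ 2 + c 1 * a + c 0)
    (hlb : l ≤ c 3 * b ^ 3 + c 2 * b ^ 2 + c 1 * b + c 0)
    (hlz : l ≤ c 3 * z ^ 3 + c 2 * z ^ 2 + c 1 * z + c 0)
    (hlx : l < c 3 * x₀ ^ 3 + c 2 * x₀ ^ 2 + c 1 * x₀ + c 0)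
    (hw : c 3 * D + c 2 * x₀ + c 0 ≤ w) :
    cubicRatio D x₀ a b z ≤ (w - l) / (c 3 * x₀ ^ 3 + c 2 * x₀ ^ 2 + c 1 * x₀ + c 0 - l) := by
  rw [le_div_iff₀ (sub_pos.mpr hlx)]
  have h1 : 0 < x₀ - a := by linarith
  have h2 : 0 < x₀ - b := by linarith
  have h3 : 0 < x₀ - z := by linarith
  have h4 : 0 < b - a := by linarith
  have h5 : 0 < a - z := by linarith
  have h6 : 0 < b - z := by linarith
  have key : cubicRatio D x₀ a b z * (c 3 * x₀ ^ 3 + c 2 * x₀ ^ 2 + c 1 * x₀ + c 0 - l)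
      + (D - x₀ * (x₀ + b + z) - x₀ * b * z) / ((x₀ - a) * (b - a) * (a - z)) *
        (c 3 * a ^ 3 + c 2 * a ^ 2 + c 1 * a + c 0 - l)
      + (x₀ * (x₀ + a + z) + x₀ * a * z - D) / ((x₀ - b) * (b - a) * (b - z)) *
        (c 3 * b ^ 3 + c 2 * b ^ 2 + c 1 * b + c 0 - l)
      + (x₀ * (x₀ + a + b) + x₀ * a * b - D) / ((x₀ - z) * (a - z) * (b - z)) *
        (c 3 * z ^ 3 + c 2 * z ^ 2 + c 1 * z + c 0 - l)
      = c 3 * D + c 2 * x₀ + c 0 - l := by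
    rw [cubicRatio]
    field_simp
    ring
  have ta := mul_nonneg (div_nonneg ha (by positivity : 0 ≤ (x₀ - a) * (b - a) * (a - z)))
    (sub_nonneg.mpr hla)
  have tb := mul_nonneg (div_nonneg hb (by positivity : 0 ≤ (x₀ - b) * (b - a) * (b - z)))
    (sub_nonneg.mpr hlb)
  have tz := mul_nonneg (div_nonneg hz (by positivity : 0 ≤ (x₀ - z) * (a - z) * (b - z)))
    (sub_nonneg.mpr hlz)
  linarith

end

/-! ### Regular graphs with distinct eigenvalues `θ` -/

section
variable {W : Type*} [Fintype W] [DecidableEq W] {H : SimpleGraph W} [DecidableRel H.Adj]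
  {d : ℕ} {θ : ℕ → ℝ} {r D : ℝ}

theorem AreDistinctEigenvalues.mem_spectrum (hθ : AreDistinctEigenvalues H d θ) {i : ℕ}
    (hi : i ≤ d) : θ i ∈ spectrum ℝ (H.adjMatrix ℝ) := hθ.2 ▸ ⟨i, hi, rfl⟩

theorem AreDistinctEigenvalues.exists_eq (hθ : AreDistinctEigenvalues H d θ) {x : ℝ}
    (hx : x ∈ spectrum ℝ (H.adjMatrix ℝ)) : ∃ i ≤ d, θ i = x := by
  rw [← hθ.2] at hx
  exact hx

theorem AreDistinctEigenvalues.nonempty (hθ : AreDistinctEigenvalues H d θ) : Nonempty W := by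
  by_contra h
  rw [not_nonempty_iff] at h
  exact absurd (hθ.mem_spectrum (Nat.zero_le d)) (by simp [spectrum.of_subsingleton])

theorem AreDistinctEigenvalues.lt (hθ : AreDistinctEigenvalues H d θ) {i j : ℕ}
    (hij : i < j) (hj : j ≤ d) : θ j < θ i := hθ.1 (hij.le.trans hj) hj hij

theorem AreDistinctEigenvalues.le (hθ : AreDistinctEigenvalues H d θ) {i j : ℕ}
    (hij : i ≤ j) (hj : j ≤ d) : θ j ≤ θ i := hθ.1.antitoneOn (hij.trans hj) hj hij

theorem AreDistinctEigenvalues.apply_zero_eq (hθ : AreDistinctEigenvalues H d θ)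
    {x : ℝ} (hx : IsGreatest (spectrum ℝ (H.adjMatrix ℝ)) x) : θ 0 = x := by
  obtain ⟨i, hi, h⟩ := hθ.exists_eq hx.1
  exact (hx.2 (hθ.mem_spectrum (Nat.zero_le d))).antisymm (h ▸ hθ.le (Nat.zero_le i) hi)

theorem AreDistinctEigenvalues.apply_last_eq (hθ : AreDistinctEigenvalues H d θ)
    {x : ℝ} (hx : IsLeast (spectrum ℝ (H.adjMatrix ℝ)) x) : θ d = x := by
  obtain ⟨i, hi, h⟩ := hθ.exists_eq hx.1
  exact (h ▸ hθ.le hi le_rfl : θ d ≤ x).antisymm (hx.2 (hθ.mem_spectrum le_rfl))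

/-- If `θ₀` were not positive, `-x` would be nonnegative on the spectrum; the adjacency matrix has
zero diagonal, so `0` would be the only eigenvalue. -/
theorem AreDistinctEigenvalues.zero_lt_apply_zero (hθ : AreDistinctEigenvalues H d θ) (hd : 1 ≤ d)
    (hr : ∀ v, (H.degree v : ℝ) = θ 0) : 0 < θ 0 := by
  by_contra! h0
  have h := cubic_eq_zero_of_diag_nonpos hr (c₃ := 0) (c₂ := 0) (c₁ := -1) (c₀ := 0)
    (fun x hx => by
      obtain ⟨i, hi, rfl⟩ := hθ.exists_eq hx
      linarith [hθ.le (Nat.zero_le i) hi]) (fun v => by simp)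
  have := h _ (hθ.mem_spectrum (Nat.zero_le d))
  have := h _ (hθ.mem_spectrum hd)
  linarith [hθ.lt zero_lt_one hd]

/-- If `-1` were a lower bound for the spectrum, `(θ₀ - x) (x + 1)` would be nonnegative on it, and
its value at the adjacency matrix has zero diagonal, so that `θ₀` and `-1` would be the only
eigenvalues. -/
theorem AreDistinctEigenvalues.apply_last_lt_neg_one (hθ : AreDistinctEigenvalues H d θ)
    (hd : 2 ≤ d) (hr : ∀ v, (H.degree v : ℝ) = θ 0) : θ d < -1 := by
  by_contra! hlast
  have h := cubic_eq_zero_of_diag_nonpos hr (c₃ := 0) (c₂ := -1) (c₁ := θ 0 - 1) (c₀ := θ 0)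
    (fun x hx => by
      obtain ⟨i, hi, rfl⟩ := hθ.exists_eq hx
      nlinarith [mul_nonneg (sub_nonneg.mpr (hθ.le (Nat.zero_le i) hi))
        (by linarith [hθ.le hi le_rfl] : 0 ≤ θ i + 1)]) (fun v => by simp)
  have h1 := h _ (hθ.mem_spectrum (by omega : 1 ≤ d))
  have h01 := hθ.lt zero_lt_one (by omega : 1 ≤ d)
  have h1d := hθ.lt (by omega : 1 < d) le_rfl
  have : 0 < (θ 0 - θ 1) * (θ 1 + 1) := mul_pos (by linarith) (by linarith)
  linarith

/-- The diagonal entries of `(θ₀ - x) (x - a) (x - b)` at the adjacency matrix. -/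
theorem AreDistinctEigenvalues.moment_nonneg (hθ : AreDistinctEigenvalues H d θ)
    (hr : ∀ v, (H.degree v : ℝ) = θ 0) {a b : ℝ}
    (hab : ∀ i ≤ d, 0 ≤ (θ i - a) * (θ i - b)) (v : W) :
    0 ≤ θ 0 * (θ 0 + a + b) + θ 0 * a * b - (H.adjMatrix ℝ ^ 3) v v := by
  have := diag_cubic_nonneg hr (c₃ := -1) (c₂ := θ 0 + a + b) (c₁ := -(θ 0 * a + θ 0 * b + a * b))
    (c₀ := θ 0 * a * b) (fun x hx => by
      obtain ⟨i, hi, rfl⟩ := hθ.exists_eq hx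
      nlinarith [mul_nonneg (sub_nonneg.mpr (hθ.le (Nat.zero_le i) hi)) (hab i hi)]) v
  linarith

/-- The polynomial `(θ₀ - x) (x - θ_d) (θ₁ - x)` is nonnegative on the spectrum, and its diagonal
entries grow with the number of closed `3`-walks. If the largest one were not positive, all of them
would vanish, and `θ₀, θ₁, θ_d` would be the only eigenvalues. -/
theorem AreDistinctEigenvalues.moment_pos (hθ : AreDistinctEigenvalues H d θ) (hd : 3 ≤ d)
    (hr : ∀ v, (H.degree v : ℝ) = θ 0) :
    0 < maxDiag (H.adjMatrix ℝ ^ 3) - θ 0 * (θ 0 + θ 1 + θ d) - θ 0 * θ 1 * θ d := by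
  by_contra! hD
  have h := cubic_eq_zero_of_diag_nonpos hr (c₃ := 1) (c₂ := -(θ 0 + θ 1 + θ d))
    (c₁ := θ 0 * θ 1 + θ 0 * θ d + θ 1 * θ d) (c₀ := -(θ 0 * θ 1 * θ d))
    (fun x hx => by
      obtain ⟨i, hi, rfl⟩ := hθ.exists_eq hx
      have hprod : 0 ≤ (θ 0 - θ i) * (θ 1 - θ i) := by
        rcases Nat.eq_zero_or_pos i with rfl | hpos
        · simp
        · exact mul_nonneg (sub_nonneg.mpr (hθ.le (Nat.zero_le i) hi))
            (sub_nonneg.mpr (hθ.le hpos hi))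
      nlinarith [mul_nonneg hprod (sub_nonneg.mpr (hθ.le hi le_rfl))])
    (fun v => by linarith [le_maxDiag (H.adjMatrix ℝ ^ 3) v])
  have h2 := h _ (hθ.mem_spectrum (by omega : 2 ≤ d))
  have h02 := hθ.lt (by omega : 0 < 2) (by omega)
  have h12 := hθ.lt (by omega : 1 < 2) (by omega)
  have h2d := hθ.lt (by omega : 2 < d) le_rfl
  have : 0 < (θ 0 - θ 2) * (θ 1 - θ 2) * (θ 2 - θ d) :=
    mul_pos (mul_pos (by linarith) (by linarith)) (by linarith)
  linarith

/-! ### The threshold -/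

/-- The threshold `-((θ₀² + θ₀ θ_d - D) / (θ₀ (θ_d + 1)))` is the mean of `x` for the weight
`(θ₀ - x) (x - θ_d)` under the functional with moments `1, 0, θ₀, D`; the right-hand side is the value
of that functional at `(θ₀ - x) (x - θ_d) (y - x)`. -/
theorem lt_threshold_iff {x₀ z D y : ℝ} (hx : 0 < x₀) (hz : z < -1) :
    -((x₀ ^ 2 + x₀ * z - D) / (x₀ * (z + 1))) < y ↔
      0 < D - x₀ * (x₀ + y + z) - x₀ * y * z := by
  have hP : 0 < x₀ * (-(z + 1)) := mul_pos hx (by linarith)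
  rw [← div_neg, ← mul_neg, div_lt_iff₀ hP, ← sub_pos]
  ring_nf

theorem AreDistinctEigenvalues.exists_threshold_index (hθ : AreDistinctEigenvalues H d θ)
    (hd : 3 ≤ d) (hr : ∀ v, (H.degree v : ℝ) = θ 0)
    (hD : D = maxDiag (H.adjMatrix ℝ ^ 3)) :
    ∃ s, 2 ≤ s ∧ s < d ∧
      IsGreatest {x : ℝ | x ∈ spectrum ℝ (H.adjMatrix ℝ) ∧
        x ≤ -((θ 0 ^ 2 + θ 0 * θ d - D) / (θ 0 * (θ d + 1)))} (θ s) ∧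
      -((θ 0 ^ 2 + θ 0 * θ d - D) / (θ 0 * (θ d + 1))) < θ (s - 1) := by
  have h0 := hθ.zero_lt_apply_zero (by omega) hr
  have hz := hθ.apply_last_lt_neg_one (by omega) hr
  set τ := -((θ 0 ^ 2 + θ 0 * θ d - D) / (θ 0 * (θ d + 1))) with hτ
  have := hθ.nonempty
  obtain ⟨v, hv⟩ := exists_eq_maxDiag (H.adjMatrix ℝ ^ 3)
  -- The cubic `(θ₀ - x) (x - θ_{d-1}) (x - θ_d)` is nonnegative on the spectrum.
  have hex : θ (d - 1) ≤ τ := by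
    rw [hτ, ← not_lt, lt_threshold_iff h0 hz, not_lt]
    have := hθ.moment_nonneg hr (a := θ (d - 1)) (b := θ d) (fun i hi => by
      rcases hi.eq_or_lt with rfl | hlt
      · simp
      · exact mul_nonneg (sub_nonneg.mpr (hθ.le (Nat.le_sub_one_of_lt hlt) (Nat.sub_le _ _)))
          (sub_nonneg.mpr (hθ.le hi le_rfl))) v
    rw [hv, ← hD] at this
    linarith
  have h1 : τ < θ 1 := by
    rw [hτ, lt_threshold_iff h0 hz, hD]
    exact hθ.moment_pos hd hr
  classical
  have hexists : ∃ i, θ i ≤ τ := ⟨d - 1, hex⟩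
  have hs := Nat.find_spec hexists
  have hmin : ∀ i, θ i ≤ τ → Nat.find hexists ≤ i := fun i hi => Nat.find_min' hexists hi
  set s := Nat.find hexists
  have hsd : s ≤ d - 1 := hmin _ hex
  have hs2 : 2 ≤ s := by
    by_contra hlt
    have h01 := hθ.lt zero_lt_one (by omega)
    rcases (by omega : s = 0 ∨ s = 1) with h | h <;> rw [h] at hs <;> linarith
  refine ⟨s, hs2, by omega, ⟨⟨hθ.mem_spectrum (by omega), hs⟩, ?_⟩, ?_⟩
  · rintro x ⟨hx, hxτ⟩
    obtain ⟨i, hi, rfl⟩ := hθ.exists_eq hx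
    exact hθ.le (hmin i hxτ) hi
  · by_contra! h
    have := hmin _ h
    omega

/-! ### The optimal cubic -/

/-- The monic cubic with roots `a, b, z`, written by its coefficients. For `a = θ_s`,
`b = θ_{s-1}`, `z = θ_d` it attains the best Hoffman-type bound. -/
noncomputable def rootCubic (a b z : ℝ) : ℝ[X] :=
  C 1 * X ^ 3 + C (-(a + b + z)) * X ^ 2 + C (a * b + a * z + b * z) * X + C (-(a * b * z))

theorem eval_rootCubic (a b z x : ℝ) :
    (rootCubic a b z).eval x = (x - a) * (x - b) * (x - z) := by
  simp [rootCubic]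
  ring

theorem natDegree_rootCubic_le (a b z : ℝ) : (rootCubic a b z).natDegree ≤ 3 :=
  natDegree_cubic_le

theorem aeval_rootCubic_apply_self (hr : ∀ v, (H.degree v : ℝ) = r) (a b z : ℝ) (v : W) :
    aeval (H.adjMatrix ℝ) (rootCubic a b z) v v =
      (H.adjMatrix ℝ ^ 3) v v - r * (a + b + z) - a * b * z := by
  rw [rootCubic, aeval_cubic_adjMatrix_apply_self hr]
  ring

theorem maxDiag_aeval_rootCubic [Nonempty W] (hr : ∀ v, (H.degree v : ℝ) = r) (a b z : ℝ) :
    maxDiag (aeval (H.adjMatrix ℝ) (rootCubic a b z)) =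
      maxDiag (H.adjMatrix ℝ ^ 3) - r * (a + b + z) - a * b * z := by
  apply le_antisymm
  · refine ciSup_le fun v => ?_
    rw [aeval_rootCubic_apply_self hr]
    linarith [le_maxDiag (H.adjMatrix ℝ ^ 3) v]
  · obtain ⟨v, hv⟩ := exists_eq_maxDiag (H.adjMatrix ℝ ^ 3)
    rw [← hv, ← aeval_rootCubic_apply_self hr]
    exact le_maxDiag _ v

theorem AreDistinctEigenvalues.eval_rootCubic_nonneg (hθ : AreDistinctEigenvalues H d θ)
    {s : ℕ} (hs : s ≤ d) {x : ℝ} (hx : x ∈ spectrum ℝ (H.adjMatrix ℝ)) :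
    0 ≤ (rootCubic (θ s) (θ (s - 1)) (θ d)).eval x := by
  obtain ⟨i, hi, rfl⟩ := hθ.exists_eq hx
  rw [eval_rootCubic]
  refine mul_nonneg ?_ (sub_nonneg.mpr (hθ.le hi le_rfl))
  rcases lt_or_ge i s with h | h
  · exact mul_nonneg (sub_nonneg.mpr (hθ.le h.le hs))
      (sub_nonneg.mpr (hθ.le (Nat.le_sub_one_of_lt h) (by omega)))
  · exact mul_nonneg_of_nonpos_of_nonpos (sub_nonpos.mpr (hθ.le h hi))
      (sub_nonpos.mpr (hθ.le (by omega) hi))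

theorem AreDistinctEigenvalues.eval_rootCubic_pos (hθ : AreDistinctEigenvalues H d θ)
    {s : ℕ} (hs : 2 ≤ s) (hsd : s ≤ d) :
    0 < (rootCubic (θ s) (θ (s - 1)) (θ d)).eval (θ 0) := by
  rw [eval_rootCubic]
  exact mul_pos (mul_pos (sub_pos.mpr (hθ.lt (by omega) hsd))
    (sub_pos.mpr (hθ.lt (by omega) (by omega)))) (sub_pos.mpr (hθ.lt (by omega) le_rfl))

/-- The Hoffman bound given by the optimal cubic, for vertices pairwise at distance more than `3`. -/
theorem AreDistinctEigenvalues.card_le_card_mul_cubicRatio (hθ : AreDistinctEigenvalues H d θ)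
    (hr : ∀ v, (H.degree v : ℝ) = θ 0) (hD : D = maxDiag (H.adjMatrix ℝ ^ 3))
    {s : ℕ} (hs : 2 ≤ s) (hsd : s ≤ d) {S : Finset W} (hne : S.Nonempty)
    (hS : ∀ u ∈ S, ∀ v ∈ S, u ≠ v → ∀ q : H.Walk u v, 3 < q.length) :
    (S.card : ℝ) ≤ Fintype.card W * cubicRatio D (θ 0) (θ s) (θ (s - 1)) (θ d) := by
  have := hθ.nonempty
  have h := card_mul_eval_le_of_aeval_apply_eq_zero isHermitian_adjMatrix
    (adjMatrix_mulVec_one_of_degree_eq hr) (p := rootCubic (θ s) (θ (s - 1)) (θ d))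
    (fun x hx => hθ.eval_rootCubic_nonneg hsd hx) hne
    (fun u hu v hv huv => aeval_adjMatrix_apply_eq_zero fun q =>
      (natDegree_rootCubic_le _ _ _).trans_lt (hS u hu v hv huv q))
    (fun v _ => le_maxDiag _ v)
  rw [maxDiag_aeval_rootCubic hr, ← hD] at h
  rw [cubicRatio, ← eval_rootCubic, ← mul_div_assoc, le_div_iff₀ (hθ.eval_rootCubic_pos hs hsd)]
  exact h

/-- A single vertex is a family as in the Hoffman bound, so that bound is at least `1`. -/
theorem AreDistinctEigenvalues.floor_cubicRatio_pos (hθ : AreDistinctEigenvalues H d θ)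
    (hr : ∀ v, (H.degree v : ℝ) = θ 0) (hD : D = maxDiag (H.adjMatrix ℝ ^ 3))
    {s : ℕ} (hs : 2 ≤ s) (hsd : s ≤ d) :
    0 < ⌊(Fintype.card W : ℝ) * cubicRatio D (θ 0) (θ s) (θ (s - 1)) (θ d)⌋ := by
  obtain ⟨v⟩ := hθ.nonempty
  have h := hθ.card_le_card_mul_cubicRatio hr hD hs hsd (Finset.singleton_nonempty v)
    (by simp_all)
  rw [Int.floor_pos]
  simpa using h

theorem AreDistinctEigenvalues.hoffmanTypeBound_rootCubic (hθ : AreDistinctEigenvalues H d θ)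
    (hr : ∀ v, (H.degree v : ℝ) = θ 0) (hD : D = maxDiag (H.adjMatrix ℝ ^ 3))
    {s : ℕ} (hs : 2 ≤ s) (hsd : s ≤ d) :
    minEvalTail H (rootCubic (θ s) (θ (s - 1)) (θ d)) = 0 ∧
    hoffmanTypeBound H (rootCubic (θ s) (θ (s - 1)) (θ d)) = Fintype.card W /
      (⌊(Fintype.card W : ℝ) * cubicRatio D (θ 0) (θ s) (θ (s - 1)) (θ d)⌋ : ℤ) := by
  have := hθ.nonempty
  have h0 : adjEigenvalue H 0 = θ 0 := (hθ.apply_zero_eq isGreatest_adjEigenvalue_zero).symm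
  have hmin : minEvalTail H (rootCubic (θ s) (θ (s - 1)) (θ d)) = 0 :=
    minEvalTail_eq_zero (fun x hx => hθ.eval_rootCubic_nonneg hsd hx) (hθ.mem_spectrum le_rfl)
      (h0 ▸ (hθ.lt (by omega) le_rfl).ne) (by simp [eval_rootCubic])
  refine ⟨hmin, ?_⟩
  rw [hoffmanTypeBound, hmin, h0, maxDiag_aeval_rootCubic hr, eval_rootCubic, sub_zero, sub_zero,
    cubicRatio, ← hD]

/-- No cubic beats `rootCubic`, by the weights of `cubicRatio_le`: those at `θ_s` and `θ_{s-1}` are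
nonnegative because the threshold lies in `[θ_s, θ_{s-1}]`, and that at `θ_d` because
`(θ₀ - x) (x - θ_s) (x - θ_{s-1})` is nonnegative on the spectrum. Only the diagonal entry of `p(A)`
at a vertex with the most closed `3`-walks is used of the largest one. -/
theorem AreDistinctEigenvalues.hoffmanTypeBound_le (hθ : AreDistinctEigenvalues H d θ)
    (hd : 3 ≤ d) (hr : ∀ v, (H.degree v : ℝ) = θ 0) (hD : D = maxDiag (H.adjMatrix ℝ ^ 3))
    {s : ℕ} (hs : 2 ≤ s) (hsd : s < d)
    (hsτ : θ s ≤ -((θ 0 ^ 2 + θ 0 * θ d - D) / (θ 0 * (θ d + 1))))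
    (hτs : -((θ 0 ^ 2 + θ 0 * θ d - D) / (θ 0 * (θ d + 1))) < θ (s - 1))
    {p : ℝ[X]} (hp : p.natDegree ≤ 3) (hpl : minEvalTail H p < p.eval (adjEigenvalue H 0)) :
    hoffmanTypeBound H p ≤ Fintype.card W /
      (⌊(Fintype.card W : ℝ) * cubicRatio D (θ 0) (θ s) (θ (s - 1)) (θ d)⌋ : ℤ) := by
  have := hθ.nonempty
  have h0 := hθ.zero_lt_apply_zero (by omega) hr
  have hz := hθ.apply_last_lt_neg_one (by omega) hr
  have hfloor := hθ.floor_cubicRatio_pos hr hD hs hsd.le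
  have htop : adjEigenvalue H 0 = θ 0 := (hθ.apply_zero_eq isGreatest_adjEigenvalue_zero).symm
  have heval : ∀ x, p.eval x =
      p.coeff 3 * x ^ 3 + p.coeff 2 * x ^ 2 + p.coeff 1 * x + p.coeff 0 := fun x => by
    rw [eval_eq_sum_range' (Nat.lt_succ_of_le hp)]
    simp only [Finset.sum_range_succ, Finset.sum_range_zero]
    ring
  have htail : ∀ i, 0 < i → i ≤ d → minEvalTail H p ≤
      p.coeff 3 * θ i ^ 3 + p.coeff 2 * θ i ^ 2 + p.coeff 1 * θ i + p.coeff 0 := fun i hi hid => by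
    rw [← heval]
    exact minEvalTail_le (hθ.mem_spectrum hid) (htop ▸ (hθ.lt hi hid).ne)
  obtain ⟨v, hv⟩ := exists_eq_maxDiag (H.adjMatrix ℝ ^ 3)
  have hW := le_maxDiag (aeval (H.adjMatrix ℝ) p) v
  rw [aeval_adjMatrix_apply_self hr hp, hv, ← hD] at hW
  have hb := not_lt.mpr hsτ
  rw [lt_threshold_iff h0 hz, not_lt] at hb
  have ha := (lt_threshold_iff h0 hz).mp hτs
  have hab : ∀ i ≤ d, 0 ≤ (θ i - θ s) * (θ i - θ (s - 1)) := fun i hi => by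
    rcases lt_or_ge i s with h | h
    · exact mul_nonneg (sub_nonneg.mpr (hθ.le h.le hsd.le))
        (sub_nonneg.mpr (hθ.le (Nat.le_sub_one_of_lt h) (by omega)))
    · exact mul_nonneg_of_nonpos_of_nonpos (sub_nonpos.mpr (hθ.le h hi))
        (sub_nonpos.mpr (hθ.le (by omega) hi))
  have hzm := hθ.moment_nonneg hr hab v
  rw [hv, ← hD] at hzm
  rw [htop, heval] at hpl
  have key := cubicRatio_le (hθ.lt hsd le_rfl) (hθ.lt (by omega : s - 1 < s) hsd.le)
    (hθ.lt (by omega : 0 < s - 1) (by omega)) ha.le (by linarith) hzm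
    (htail s (by omega) hsd.le) (htail (s - 1) (by omega) (by omega)) (htail d (by omega) le_rfl)
    hpl hW
  rw [← heval, ← htop] at key
  rw [hoffmanTypeBound]
  refine div_le_div_of_nonneg_left (Nat.cast_nonneg _) (by exact_mod_cast hfloor) ?_
  rw [htop] at key ⊢
  exact_mod_cast Int.floor_le_floor (mul_le_mul_of_nonneg_left key (Nat.cast_nonneg _))

end

/-! ### The distance-3 chromatic index -/

theorem corollary3p7 {V : Type*} [Fintype V] [DecidableEq V] (G : SimpleGraph V)
    [DecidableRel G.Adj] [DecidableRel G.lineGraph.Adj]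
    (k : ℕ) (hk : G.IsRegularOfDegree k)
    (d : ℕ) (hd : 3 ≤ d) (θ : ℕ → ℝ) (hθ : AreDistinctEigenvalues G.lineGraph d θ)
    (D : ℝ) (hD : D = maxDiag (G.lineGraph.adjMatrix ℝ ^ 3)) :
    θ 0 = 2 * ((k : ℝ) - 1) ∧ (3 ≤ k → θ d = -2) ∧
    ∃ s : ℕ, 2 ≤ s ∧ s < d ∧
      -- `θ s` is the largest eigenvalue that does not exceed the threshold
      IsGreatest {x : ℝ | x ∈ spectrum ℝ (G.lineGraph.adjMatrix ℝ) ∧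
        x ≤ -((θ 0 ^ 2 + θ 0 * θ d - D) / (θ 0 * (θ d + 1)))} (θ s) ∧
      0 < ⌊(Fintype.card G.edgeSet : ℝ) * cubicRatio D (θ 0) (θ s) (θ (s - 1)) (θ d)⌋ ∧
      -- the lower bound
      (Fintype.card G.edgeSet : ℝ) /
          (⌊(Fintype.card G.edgeSet : ℝ) * cubicRatio D (θ 0) (θ s) (θ (s - 1)) (θ d)⌋ : ℤ)
        ≤ (distChromaticIndex G 3 : ℝ) ∧
      -- it is the best bound that the Hoffman-type bound gives with polynomials of degree `≤ 3`
      IsGreatest {b : ℝ | ∃ p : Polynomial ℝ, p.natDegree ≤ 3 ∧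
          minEvalTail G.lineGraph p < p.eval (adjEigenvalue G.lineGraph 0) ∧
          b = hoffmanTypeBound G.lineGraph p}
        ((Fintype.card G.edgeSet : ℝ) /
          (⌊(Fintype.card G.edgeSet : ℝ) *
            cubicRatio D (θ 0) (θ s) (θ (s - 1)) (θ d)⌋ : ℤ)) := by
  have hE := hθ.nonempty
  have htop : θ 0 = 2 * ((k : ℝ) - 1) :=
    hθ.apply_zero_eq (isGreatest_spectrum_adjMatrix (degree_lineGraph_of_isRegularOfDegree hk))
  have hr : ∀ e, (G.lineGraph.degree e : ℝ) = θ 0 := fun e =>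
    (degree_lineGraph_of_isRegularOfDegree hk e).trans htop.symm
  refine ⟨htop, fun h3 => ?_, ?_⟩
  · have hV : Nonempty V := by
      obtain ⟨⟨e, -⟩⟩ := hE
      induction e with | _ a b => exact ⟨a⟩
    exact hθ.apply_last_eq ⟨neg_two_mem_spectrum_lineGraph (card_lt_card_edgeSet G hk h3),
      fun x hx => neg_two_le_of_mem_spectrum_lineGraph hx⟩
  obtain ⟨s, hs, hsd, hgreatest, hτ⟩ := hθ.exists_threshold_index hd hr hD
  have hfloor := hθ.floor_cubicRatio_pos hr hD hs hsd.le
  obtain ⟨hmin, hbound⟩ := hθ.hoffmanTypeBound_rootCubic hr hD hs hsd.le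
  refine ⟨s, hs, hsd, hgreatest, hfloor, ?_, ⟨rootCubic (θ s) (θ (s - 1)) (θ d),
    natDegree_rootCubic_le _ _ _, ?_, hbound.symm⟩, ?_⟩
  · set n := ⌊(Fintype.card G.edgeSet : ℝ) * cubicRatio D (θ 0) (θ s) (θ (s - 1)) (θ d)⌋ with hn
    have hcard := card_le_distChromaticIndex_mul G (t := 3) (N := n.toNat) fun S hS => by
      rcases S.eq_empty_or_nonempty with rfl | hne
      · simp
      · have h := hθ.card_le_card_mul_cubicRatio hr hD hs hsd.le hne
          fun e he f hf hef q => by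
            by_contra! hq
            exact hS e he f hf hef (edgesWithinDist_of_lineGraph_walk hef q hq)
        have h' : (S.card : ℤ) ≤ n := Int.le_floor.mpr (by exact_mod_cast h)
        omega
    have hnat : ((n.toNat : ℕ) : ℝ) = (n : ℝ) := by
      exact_mod_cast Int.toNat_of_nonneg hfloor.le
    rw [div_le_iff₀ (by exact_mod_cast hfloor), ← hnat]
    exact_mod_cast hcard
  · rw [hmin, ← hθ.apply_zero_eq isGreatest_adjEigenvalue_zero]
    exact hθ.eval_rootCubic_pos hs hsd.le
  · rintro _ ⟨p, hp, hpl, rfl⟩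
    exact hθ.hoffmanTypeBound_le hd hr hD hs hsd hgreatest.1.2 hτ hp hpl
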